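/- Let $k$ be a field and let $G = N \rtimes K$ be an affine group scheme over $k$, where $N$ is a normal closed subgroup scheme, $K$ is a closed subgroup scheme, and multiplication $N \times K \to G$ is an isomorphism of schemes. Let $k[G], k[N], k[K]$ be the coordinate Hopf algebras, with $\Delta(f)=\sum f_{(1)}\otimes f_{(2)}$, $f(xy) = \sum f_{(1)}(x) f_{(2)}(y)$. For a $k$-coalgebra $C$, a (left) $C$-contramodule is a $k$-vector space $M$ with a linear map $\theta_M : \operatorname{Hom}_k(C,M)\to M$ such that $\theta_M(\varepsilon(\cdot)m)=m$ for all $m \in M$, and $\theta_M\big(c\mapsto \theta_M(\varphi(c))\big)=\theta_M\big(c\mapsto \sum\varphi(c_{(2)})(c_{(1)})\big)$ for all linear $\varphi: C\to\operatorname{Hom}_k(C,M)$. The free $C$-contramodule on a vector space $V$ is $\operatorname{Hom}_k(C,V)$ with contra-action $\varphi\mapsto\big(c\mapsto \sum\varphi(c_{(2)})(c_{(1)})\big)$. Restriction along a coalgebra map $\pi : C\to D$ turns a $C$-contramodule $(M,\theta_M)$ into the $D$-contramodule with contra-action $\varphi\mapsto\theta_M(\varphi\circ\pi)$. For a $D$-contramodule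 $M$, the induced $C$-contramodule $\operatorname{Ind}_D^C M$ is the coequaliser of the two maps $\operatorname{Hom}_k(D\otimes C, M)\rightrightarrows\operatorname{Hom}_k(C,M)$ sending $\omega$ to $c\mapsto\sum\omega(\pi(c_{(1)})\otimes c_{(2)})$ and to $c\mapsto\theta_M(d\mapsto\omega(d\otimes c))$, with the contra-action it inherits as a quotient of the free $C$-contramodule $\operatorname{Hom}_k(C,M)$. Let $(M,\theta_M)$ be a $k[K]$-contramodule. Regard $k[N]$ as a right $k[K]$-comodule, $f\mapsto\sum f_{(0)}\otimes f_{(1)}$, through conjugation: $\sum f_{(0)}(n)f_{(1)}(x) = f(x^{-1}nx)$ for $n \in N$, $x\in K$. Give $\operatorname{Hom}_k(k[N],M)$ the diagonal $k[K]$-contra-action $$\varphi\longmapsto\Big(f\mapsto\theta_M\big(u\mapsto\sum\varphi(f_{(1)}u)(f_{(0)})\big)\Big),\qquad \varphi\in\operatorname{Hom}_k\big(k[K],\operatorname{Hom}_k(k[N],M)\big).$$ Then there is exactly one $k[G]$-contramodule structure on $\operatorname{Hom}_k(k[N],M)$ whose restriction to $k[K]$ is this diagonal contramodule and whose restriction to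 $k[N]$ is the free $k[N]$-contramodule on $M$, and with this structure there is an isomorphism of $k[G]$-contramodules $$\operatorname{Ind}_{k[K]}^{k[G]}(M)\;\cong\;\operatorname{Hom}_k(k[N],M).$$ In particular this is an isomorphism of $k[K]$-contramodules for the diagonal structure on the right side. -/

import Mathlib

open scoped TensorProduct
open TensorProduct Coalgebra

universe u v w x

section Contra

/-- A left contramodule structure on the `k`-vector space `B` over the coalgebra `C`: a linear
contra-action `Hom(C, B) → B`.  In `contraassoc` the identification
`Hom(C, Hom(C, B)) ≅ Hom(C ⊗ C, B)` is `φ ↦ (v ⊗ u ↦ φ u v)`. -/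
@[ext]
structure Contramodule (k : Type u) (C : Type v) (B : Type w) [Field k]
    [AddCommGroup C] [Module k C] [Coalgebra k C] [AddCommGroup B] [Module k B] where
  /-- the contra-action -/
  act : (C →ₗ[k] B) →ₗ[k] B
  contraassoc : ∀ φ : C →ₗ[k] C →ₗ[k] B,
    act (act ∘ₗ φ) = act (TensorProduct.lift φ.flip ∘ₗ comul)
  contraunit : ∀ b : B, act ((counit : C →ₗ[k] k).smulRight b) = b

/-- A right comodule over the coalgebra `C`. -/
structure RightComodule (k : Type u) (C : Type v) (M : Type w) [Field k]
    [AddCommGroup C] [Module k C] [Coalgebra k C] [AddCommGroup M] [Module k M] where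
  /-- the coaction -/
  coact : M →ₗ[k] M ⊗[k] C
  coassoc : TensorProduct.assoc k M C C ∘ₗ coact.rTensor C ∘ₗ coact =
    (comul : C →ₗ[k] C ⊗[k] C).lTensor M ∘ₗ coact
  counit_coact : ∀ m : M, (counit : C →ₗ[k] k).lTensor M (coact m) = m ⊗ₜ[k] (1 : k)

/-- A left comodule over the coalgebra `C`. -/
structure LeftComodule (k : Type u) (C : Type v) (M : Type w) [Field k]
    [AddCommGroup C] [Module k C] [Coalgebra k C] [AddCommGroup M] [Module k M] where
  /-- the coaction -/
  coact : M →ₗ[k] C ⊗[k] M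
  coassoc : TensorProduct.assoc k C C M ∘ₗ (comul : C →ₗ[k] C ⊗[k] C).rTensor M ∘ₗ coact =
    coact.lTensor C ∘ₗ coact
  counit_coact : ∀ m : M, (counit : C →ₗ[k] k).rTensor M (coact m) = (1 : k) ⊗ₜ[k] m

namespace Contramodule

variable {k : Type u} [Field k]
variable {C : Type v} [AddCommGroup C] [Module k C] [Coalgebra k C]
variable {D : Type w} [AddCommGroup D] [Module k D] [Coalgebra k D]
variable {B : Type x} [AddCommGroup B] [Module k B]

/-- A linear map `f : B → B'` is a homomorphism of contramodules. -/
def IsHom {B' : Type*} [AddCommGroup B'] [Module k B'] (S : Contramodule k C B)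
    (T : Contramodule k C B') (f : B →ₗ[k] B') : Prop :=
  ∀ φ : C →ₗ[k] B, f (S.act φ) = T.act (f ∘ₗ φ)

/-- The contramodules `(B, S)` and `(B', T)` are isomorphic. -/
def IsIsomorphic {B' : Type*} [AddCommGroup B'] [Module k B'] (S : Contramodule k C B)
    (T : Contramodule k C B') : Prop :=
  ∃ e : B ≃ₗ[k] B', S.IsHom T e.toLinearMap

/-- Restriction of a `C`-contramodule along a coalgebra map `π : C → D`. -/
def res (T : Contramodule k C B) (π : C →ₗc[k] D) : Contramodule k D B where
  act := T.act ∘ₗ LinearMap.lcomp k B π.toLinearMap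
  contraassoc φ := by
    have h := T.contraassoc ((LinearMap.lcomp k B π.toLinearMap ∘ₗ φ) ∘ₗ π.toLinearMap)
    have e : TensorProduct.lift
        ((LinearMap.lcomp k B π.toLinearMap ∘ₗ φ) ∘ₗ π.toLinearMap).flip =
        TensorProduct.lift φ.flip ∘ₗ TensorProduct.map π.toLinearMap π.toLinearMap := by
      ext; simp
    have e' : (TensorProduct.lift φ.flip ∘ₗ TensorProduct.map π.toLinearMap π.toLinearMap) ∘ₗ
        comul = (TensorProduct.lift φ.flip ∘ₗ comul) ∘ₗ π.toLinearMap := by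
      rw [LinearMap.comp_assoc, π.map_comp_comul, LinearMap.comp_assoc]
    rw [e, e'] at h
    exact h
  contraunit b := by
    have h := T.contraunit b
    rw [← π.counit_comp] at h
    exact h

variable (k C) in
/-- The free `C`-contramodule `Hom(C, V)`; its contra-action is
`Hom(C, Hom(C, V)) ≅ Hom(C ⊗ C, V) → Hom(C, V)`, composition with the comultiplication. -/
def free (V : Type x) [AddCommGroup V] [Module k V] : Contramodule k C (C →ₗ[k] V) where
  act :=
    { toFun := fun ψ => TensorProduct.lift ψ.flip ∘ₗ comul
      map_add' := fun ψ ψ' => by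
        rw [← LinearMap.add_comp]; congr 1; ext; simp
      map_smul' := fun r ψ => by
        rw [RingHom.id_apply, ← LinearMap.smul_comp]; congr 1; ext; simp }
  contraassoc Φ := by
    ext c
    let L : C ⊗[k] (C ⊗[k] C) →ₗ[k] V :=
      TensorProduct.lift ((TensorProduct.lift.equiv (RingHom.id k) C C (C →ₗ[k] V)) Φ.flip).flip
    have hL : ∀ a b d, L (a ⊗ₜ (b ⊗ₜ d)) = Φ d b a := fun a b d => by simp [L]
    have h1 : ∀ (y : C) (s : C ⊗[k] C), TensorProduct.lift (Φ y).flip s =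
        L (TensorProduct.assoc k C C C (s ⊗ₜ y)) := by
      intro y s
      induction s with
      | zero => simp
      | tmul a b => simp [hL]
      | add a b ha hb => simp only [map_add, add_tmul, ha, hb]
    have h2 : ∀ (y : C) (s : C ⊗[k] C), TensorProduct.lift Φ.flip s y = L (y ⊗ₜ s) := by
      intro y s
      induction s with
      | zero => simp
      | tmul a b => simp [hL]
      | add a b ha hb => simp only [map_add, tmul_add, LinearMap.add_apply, ha, hb]
    have h3 : ∀ t : C ⊗[k] C, TensorProduct.lift (LinearMap.flip
        (({ toFun := fun ψ => TensorProduct.lift ψ.flip ∘ₗ comul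
            map_add' := fun ψ ψ' => by
              rw [← LinearMap.add_comp]; congr 1; ext; simp
            map_smul' := fun r ψ => by
              rw [RingHom.id_apply, ← LinearMap.smul_comp]; congr 1; ext; simp } :
              (C →ₗ[k] C →ₗ[k] V) →ₗ[k] C →ₗ[k] V) ∘ₗ Φ)) t =
        L (TensorProduct.assoc k C C C ((comul : C →ₗ[k] C ⊗[k] C).rTensor C t)) := by
      intro t
      induction t with
      | zero => simp
      | tmul a b => simp [h1]
      | add a b ha hb => simp only [map_add, ha, hb]
    have h4 : ∀ t : C ⊗[k] C,
        TensorProduct.lift (LinearMap.flip (TensorProduct.lift Φ.flip ∘ₗ comul)) t =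
        L ((comul : C →ₗ[k] C ⊗[k] C).lTensor C t) := by
      intro t
      induction t with
      | zero => simp
      | tmul a b => simp [h2]
      | add a b ha hb => simp only [map_add, ha, hb]
    refine (h3 (comul c)).trans (Eq.trans ?_ (h4 (comul c)).symm)
    rw [Coalgebra.coassoc_apply]
  contraunit b := by
    ext c
    have h : ∀ t : C ⊗[k] C,
        TensorProduct.lift ((counit : C →ₗ[k] k).smulRight b).flip t =
        TensorProduct.lift ((LinearMap.lsmul k V).flip ∘ₗ b)
          ((counit : C →ₗ[k] k).lTensor C t) := by
      intro t
      induction t with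
      | zero => simp
      | tmul a b => simp
      | add a b ha hb => simp only [map_add, ha, hb]
    refine (h (comul c)).trans ?_
    simp

theorem free_act_apply {V : Type x} [AddCommGroup V] [Module k V] (ψ : C →ₗ[k] C →ₗ[k] V) :
    (free k C V).act ψ = TensorProduct.lift ψ.flip ∘ₗ comul := rfl

/-- A linear right inverse of a quotient map of vector spaces (an auxiliary choice; the
quotient contramodule does not depend on it, see `quotient_act_mkQ`). -/
noncomputable def quotSection (W : Submodule k B) : (B ⧸ W) →ₗ[k] B :=
  (W.mkQ.exists_rightInverse_of_surjective W.range_mkQ).choose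

theorem mkQ_comp_quotSection (W : Submodule k B) : W.mkQ ∘ₗ quotSection W = LinearMap.id :=
  (W.mkQ.exists_rightInverse_of_surjective W.range_mkQ).choose_spec

theorem mkQ_act_congr (T : Contramodule k C B) (W : Submodule k B)
    (hW : ∀ ψ : C →ₗ[k] B, (∀ c, ψ c ∈ W) → T.act ψ ∈ W) {ψ ψ' : C →ₗ[k] B}
    (h : W.mkQ ∘ₗ ψ = W.mkQ ∘ₗ ψ') : W.mkQ (T.act ψ) = W.mkQ (T.act ψ') := by
  rw [← sub_eq_zero, ← map_sub, ← map_sub, Submodule.mkQ_apply, Submodule.Quotient.mk_eq_zero]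
  refine hW _ fun c => ?_
  have := LinearMap.congr_fun h c
  simpa [Submodule.Quotient.eq] using this

/-- The quotient of a contramodule by a subcontramodule `W`: the unique contra-action for which
the quotient map is a homomorphism. -/
noncomputable def quotient (T : Contramodule k C B) (W : Submodule k B)
    (hW : ∀ ψ : C →ₗ[k] B, (∀ c, ψ c ∈ W) → T.act ψ ∈ W) : Contramodule k C (B ⧸ W) where
  act := W.mkQ ∘ₗ T.act ∘ₗ LinearMap.llcomp k C (B ⧸ W) B (quotSection W)
  contraassoc Φ := by
    have hs : ∀ q : B ⧸ W, W.mkQ (quotSection W q) = q :=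
      fun q => LinearMap.congr_fun (mkQ_comp_quotSection W) q
    let Ψ : C →ₗ[k] C →ₗ[k] B := LinearMap.llcomp k C (B ⧸ W) B (quotSection W) ∘ₗ Φ
    have h := congrArg W.mkQ (T.contraassoc Ψ)
    refine Eq.trans ?_ (h.trans ?_)
    · refine mkQ_act_congr T W hW ?_
      ext c
      change W.mkQ (quotSection W _) = W.mkQ _
      rw [hs]
      rfl
    · refine mkQ_act_congr T W hW ?_
      rw [← LinearMap.comp_assoc]
      change _ = W.mkQ ∘ₗ quotSection W ∘ₗ _
      rw [← LinearMap.comp_assoc (TensorProduct.lift Φ.flip ∘ₗ comul),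
        mkQ_comp_quotSection, LinearMap.id_comp]
      congr 1
      ext a b
      change W.mkQ (quotSection W _) = _
      rw [hs]
      rfl
  contraunit q := by
    have h := T.contraunit (quotSection W q)
    have e : LinearMap.llcomp k C (B ⧸ W) B (quotSection W) ((counit : C →ₗ[k] k).smulRight q) =
        (counit : C →ₗ[k] k).smulRight (quotSection W q) := by
      ext; simp
    change W.mkQ (T.act (LinearMap.llcomp k C (B ⧸ W) B (quotSection W) _)) = q
    rw [e, h]
    exact LinearMap.congr_fun (mkQ_comp_quotSection W) q

theorem quotient_act_mkQ (T : Contramodule k C B) (W : Submodule k B)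
    (hW : ∀ ψ : C →ₗ[k] B, (∀ c, ψ c ∈ W) → T.act ψ ∈ W) :
    T.IsHom (T.quotient W hW) W.mkQ := by
  intro ψ
  refine mkQ_act_congr T W hW ?_
  ext c
  exact (LinearMap.congr_fun (mkQ_comp_quotSection W) (W.mkQ (ψ c))).symm

end Contramodule

/-- A coalgebra map `π : C → D` makes `C` a left `D`-comodule, with coaction
`(π ⊗ id) ∘ Δ`. -/
def LeftComodule.ofCoalgHom {k : Type u} [Field k]
    {C : Type v} [AddCommGroup C] [Module k C] [Coalgebra k C]
    {D : Type w} [AddCommGroup D] [Module k D] [Coalgebra k D] (π : C →ₗc[k] D) :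
    LeftComodule k D C where
  coact := π.toLinearMap.rTensor C ∘ₗ comul
  coassoc := by
    have h1 : ∀ t : C ⊗[k] C,
        TensorProduct.assoc k D D C ((comul : D →ₗ[k] D ⊗[k] D).rTensor C
          (π.toLinearMap.rTensor C t)) =
        TensorProduct.map π.toLinearMap (π.toLinearMap.rTensor C)
          (TensorProduct.assoc k C C C ((comul : C →ₗ[k] C ⊗[k] C).rTensor C t)) := by
      intro t
      induction t with
      | zero => simp
      | tmul a b =>
        have h2 : ∀ s : C ⊗[k] C, TensorProduct.assoc k D D C
            ((TensorProduct.map π.toLinearMap π.toLinearMap s) ⊗ₜ b) =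
            TensorProduct.map π.toLinearMap (π.toLinearMap.rTensor C)
              (TensorProduct.assoc k C C C (s ⊗ₜ b)) := by
          intro s
          induction s with
          | zero => simp
          | tmul x y => simp
          | add x y hx hy => simp only [map_add, add_tmul, hx, hy]
        have h3 := LinearMap.congr_fun π.map_comp_comul a
        simp only [LinearMap.rTensor_tmul]
        rw [← h2]
        simp only [LinearMap.comp_apply] at h3
        rw [h3]
      | add a b ha hb => simp only [map_add, ha, hb]
    have h4 : ∀ t : C ⊗[k] C,
        (π.toLinearMap.rTensor C ∘ₗ (comul : C →ₗ[k] C ⊗[k] C)).lTensor D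
          (π.toLinearMap.rTensor C t) =
        TensorProduct.map π.toLinearMap (π.toLinearMap.rTensor C)
          ((comul : C →ₗ[k] C ⊗[k] C).lTensor C t) := by
      intro t
      induction t with
      | zero => simp
      | tmul a b => simp
      | add a b ha hb => simp only [map_add, ha, hb]
    ext c
    refine (h1 (comul c)).trans (Eq.trans ?_ (h4 (comul c)).symm)
    rw [Coalgebra.coassoc_apply]
  counit_coact c := by
    have h : ∀ t : C ⊗[k] C, (counit : D →ₗ[k] k).rTensor C (π.toLinearMap.rTensor C t) =
        (counit : C →ₗ[k] k).rTensor C t := by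
      intro t
      rw [← LinearMap.comp_apply, ← LinearMap.rTensor_comp, π.counit_comp]
    exact (h (comul c)).trans (Coalgebra.rTensor_counit_comul c)

namespace Contramodule

variable {k : Type u} [Field k]
variable {C : Type v} [AddCommGroup C] [Module k C] [Coalgebra k C]
variable {D : Type w} [AddCommGroup D] [Module k D] [Coalgebra k D]
variable {B : Type x} [AddCommGroup B] [Module k B]

/-- The difference of the two maps `Hom(D ⊗ M, B) ⇉ Hom(M, B)` whose coequaliser is
`Cohom_D(M, B)`: composition with the coaction of `M`, and
`Hom(D ⊗ M, B) ≅ Hom(M, Hom(D, B)) → Hom(M, B)` given by the contra-action of `B`. -/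
def cohomRel {M : Type*} [AddCommGroup M] [Module k M] (L : LeftComodule k D M)
    (T : Contramodule k D B) : (D ⊗[k] M →ₗ[k] B) →ₗ[k] (M →ₗ[k] B) where
  toFun ω := ω ∘ₗ L.coact - T.act ∘ₗ (TensorProduct.curry ω).flip
  map_add' ω ω' := by
    have h : (TensorProduct.curry (ω + ω')).flip =
        (TensorProduct.curry ω).flip + (TensorProduct.curry ω').flip := by ext; simp
    rw [h, LinearMap.add_comp, LinearMap.comp_add]; abel
  map_smul' r ω := by
    have h : (TensorProduct.curry (r • ω)).flip = r • (TensorProduct.curry ω).flip := by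
      ext; simp
    rw [h, LinearMap.smul_comp, LinearMap.comp_smul, smul_sub, RingHom.id_apply]

/-- The space of cohomomorphisms `Cohom_D(M, B)`. -/
abbrev Cohom {M : Type*} [AddCommGroup M] [Module k M] (L : LeftComodule k D M)
    (T : Contramodule k D B) :=
  (M →ₗ[k] B) ⧸ LinearMap.range (cohomRel L T)

theorem free_act_mem_range (T : Contramodule k D B) (π : C →ₗc[k] D)
    (ψ : C →ₗ[k] C →ₗ[k] B)
    (hψ : ∀ c, ψ c ∈ LinearMap.range (cohomRel (LeftComodule.ofCoalgHom π) T)) :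
    (free k C B).act ψ ∈ LinearMap.range (cohomRel (LeftComodule.ofCoalgHom π) T) := by
  obtain ⟨χ, hχ⟩ := Module.projective_lifting_property
    (cohomRel (LeftComodule.ofCoalgHom π) T).rangeRestrict
    (ψ.codRestrict _ hψ) (LinearMap.surjective_rangeRestrict _)
  have hχ' : ∀ c, ψ c = cohomRel (LeftComodule.ofCoalgHom π) T (χ c) := fun c =>
    (congrArg Subtype.val (LinearMap.congr_fun hχ c)).symm
  let L : D ⊗[k] (C ⊗[k] C) →ₗ[k] B :=
    TensorProduct.lift χ.flip ∘ₗ (TensorProduct.assoc k D C C).symm.toLinearMap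
  have hL : ∀ d a b, L (d ⊗ₜ (a ⊗ₜ b)) = χ b (d ⊗ₜ a) := fun d a b => by simp [L]
  refine ⟨L ∘ₗ (comul : C →ₗ[k] C ⊗[k] C).lTensor D, ?_⟩
  ext c
  have h1 : ∀ t : C ⊗[k] C, TensorProduct.lift ψ.flip t =
      L (TensorProduct.map π.toLinearMap LinearMap.id
        (TensorProduct.assoc k C C C ((comul : C →ₗ[k] C ⊗[k] C).rTensor C t))) -
      T.act (LinearMap.flip (TensorProduct.curry L) t) := by
    intro t
    induction t with
    | zero => simp
    | tmul a b =>
      have h2 : ∀ s : C ⊗[k] C, χ b (π.toLinearMap.rTensor C s) =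
          L (TensorProduct.map π.toLinearMap LinearMap.id
            (TensorProduct.assoc k C C C (s ⊗ₜ b))) := by
        intro s
        induction s with
        | zero => simp
        | tmul x y => simp [hL]
        | add x y hx hy => simp only [map_add, add_tmul, hx, hy]
      have h3 : LinearMap.flip (TensorProduct.curry (χ b)) a =
          LinearMap.flip (TensorProduct.curry L) (a ⊗ₜ b) := by
        ext d; simp [hL]
      simp only [TensorProduct.lift.tmul, LinearMap.flip_apply, hχ', LinearMap.rTensor_tmul]
      rw [← h2]
      change χ b (π.toLinearMap.rTensor C (comul a)) - T.act _ = _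
      rw [h3]
    | add a b ha hb => simp only [map_add, ha, hb]; abel
  refine Eq.trans ?_ (h1 (comul c)).symm
  rw [Coalgebra.coassoc_apply]
  have h5 : ∀ t : C ⊗[k] C, (comul : C →ₗ[k] C ⊗[k] C).lTensor D (π.toLinearMap.rTensor C t) =
      TensorProduct.map π.toLinearMap LinearMap.id
        ((comul : C →ₗ[k] C ⊗[k] C).lTensor C t) := by
    intro t
    induction t with
    | zero => simp
    | tmul a b => simp
    | add a b ha hb => simp only [map_add, ha, hb]
  rw [← h5]
  change L ((comul : C →ₗ[k] C ⊗[k] C).lTensor D (π.toLinearMap.rTensor C (comul c))) - T.act _ = _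
  congr 2

/-- The induced contramodule `Ind_D^C(B)`: the space `Cohom_D(C, B)` with the contra-action
it inherits as a quotient of the free contramodule `Hom(C, B)`. -/
noncomputable def ind (T : Contramodule k D B) (π : C →ₗc[k] D) :
    Contramodule k C (Cohom (LeftComodule.ofCoalgHom π) T) :=
  (free k C B).quotient _ (free_act_mem_range T π)

end Contramodule

end Contra

section Diagonal

/-- `Hom(H, Hom(M, B)) → Hom(M ⊗ H, Hom(H, B))`, composition with the multiplication of `H`
followed by the regrouping `φ ↦ (m ⊗ t ↦ (u ↦ φ (t * u) m))`. -/
def diagMap {k : Type u} [Field k] {H : Type v} [Ring H] [Algebra k H]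
    {M : Type w} [AddCommGroup M] [Module k M] {B : Type x} [AddCommGroup B] [Module k B] :
    (H →ₗ[k] M →ₗ[k] B) →ₗ[k] (M ⊗[k] H →ₗ[k] H →ₗ[k] B) where
  toFun ψ := TensorProduct.lift (LinearMap.mk₂ k
    (fun (m : M) (t : H) => ψ.flip m ∘ₗ LinearMap.mulLeft k t)
    (fun m m' t => by ext; simp) (fun r m t => by ext; simp)
    (fun m t t' => by ext; simp [add_mul]) (fun r m t => by ext; simp))
  map_add' ψ ψ' := by ext; simp
  map_smul' r ψ := by ext; simp

@[simp] theorem diagMap_tmul {k : Type u} [Field k] {H : Type v} [Ring H] [Algebra k H]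
    {M : Type w} [AddCommGroup M] [Module k M] {B : Type x} [AddCommGroup B] [Module k B]
    (ψ : H →ₗ[k] M →ₗ[k] B) (m : M) (t u : H) :
    diagMap ψ (m ⊗ₜ t) u = ψ (t * u) m := rfl

variable {k : Type u} [Field k] {H : Type v} [Ring H] [Bialgebra k H]
variable {M : Type w} [AddCommGroup M] [Module k M]
variable {B : Type x} [AddCommGroup B] [Module k B]

/-- The diagonal contra-action on `Hom(M, B)` for a right comodule `M` and a left contramodule
`B` over a bialgebra `H`: `φ ↦ (m ↦ θ_B (u ↦ φ (m₁ u) m₀))`. -/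
def Contramodule.diag (ρ : RightComodule k H M) (T : Contramodule k H B) :
    Contramodule k H (M →ₗ[k] B) where
  act :=
    { toFun := fun ψ => T.act ∘ₗ diagMap ψ ∘ₗ ρ.coact
      map_add' := fun ψ ψ' => by ext; simp
      map_smul' := fun r ψ => by ext; simp }
  contraassoc Φ := by
    ext m
    let Ψ : H ⊗[k] H →ₗ[k] M →ₗ[k] B := TensorProduct.lift Φ.flip
    have hΨ : ∀ b c, Ψ (b ⊗ₜ c) = Φ c b := fun b c => by simp [Ψ]
    let A : (H →ₗ[k] M →ₗ[k] B) →ₗ[k] (M →ₗ[k] B) :=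
      { toFun := fun ψ => T.act ∘ₗ diagMap ψ ∘ₗ ρ.coact
        map_add' := fun ψ ψ' => by ext; simp
        map_smul' := fun r ψ => by ext; simp }
    have h1 : ∀ t : M ⊗[k] H, diagMap (A ∘ₗ Φ) t =
        T.act ∘ₗ (TensorProduct.curry (diagMap Ψ
          (TensorProduct.assoc k M H H (ρ.coact.rTensor H t)))).flip := by
      intro t
      induction t with
      | zero =>
        have h0 : (TensorProduct.curry (0 : H ⊗[k] H →ₗ[k] B)).flip = 0 := by ext; simp
        simp only [map_zero, h0, LinearMap.comp_zero]
      | tmul a b =>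
        ext u
        have h2 : ∀ s : M ⊗[k] H, diagMap (Φ (b * u)) s =
            (TensorProduct.curry (diagMap Ψ (TensorProduct.assoc k M H H (s ⊗ₜ b)))).flip u := by
          intro s
          induction s with
          | zero => ext; simp
          | tmul x y => ext; simp [hΨ]
          | add x y hx hy => ext; simp [hx, hy, add_tmul]
        simp [A, h2]
      | add a b ha hb => 
        have h0 : ∀ p q : H ⊗[k] H →ₗ[k] B, (TensorProduct.curry (p + q)).flip =
            (TensorProduct.curry p).flip + (TensorProduct.curry q).flip := by
          intro p q; ext; simp
        simp only [map_add, ha, hb, h0, LinearMap.comp_add]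
    have h3 : ∀ t : M ⊗[k] H, diagMap (Ψ ∘ₗ comul) t =
        diagMap Ψ ((comul : H →ₗ[k] H ⊗[k] H).lTensor M t) ∘ₗ comul := by
      intro t
      induction t with
      | zero => ext; simp
      | tmul a b =>
        ext u
        simp [Bialgebra.comul_mul]
      | add a b ha hb => simp only [map_add, ha, hb, LinearMap.add_comp]
    change T.act (diagMap (A ∘ₗ Φ) (ρ.coact m)) = T.act (diagMap (Ψ ∘ₗ comul) (ρ.coact m))
    rw [h1, h3, T.contraassoc]
    have h4 := LinearMap.congr_fun ρ.coassoc m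
    simp only [LinearMap.comp_apply, LinearEquiv.coe_coe] at h4
    rw [h4]
    congr 2
    ext; simp
  contraunit f := by
    ext m
    have h : ∀ t : M ⊗[k] H, T.act (diagMap ((counit : H →ₗ[k] k).smulRight f) t) =
        TensorProduct.lift ((LinearMap.lsmul k B).flip ∘ₗ f)
          ((counit : H →ₗ[k] k).lTensor M t) := by
      intro t
      induction t with
      | zero => simp
      | tmul a b =>
        have h1 : diagMap ((counit : H →ₗ[k] k).smulRight f) (a ⊗ₜ b) =
            (counit b : k) • (counit : H →ₗ[k] k).smulRight (f a) := by
          ext u; simp [mul_smul]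
        rw [h1, map_smul, T.contraunit]; simp
      | add a b ha hb => simp only [map_add, ha, hb]
    refine (h (ρ.coact m)).trans ?_
    rw [ρ.counit_coact]; simp

end Diagonal

section SemidirectProduct

open Bialgebra

variable {k : Type u} [Field k]
variable {A : Type v} [CommRing A] [HopfAlgebra k A]
variable {B : Type w} [CommRing B] [HopfAlgebra k B]
variable {C : Type x} [CommRing C] [HopfAlgebra k C]

/-! An affine group scheme `G` over `k` is given by its coordinate ring `A = k[G]`, a commutative
Hopf algebra.  For a commutative `k`-algebra `R`, the group `G(R)` of its `R`-points is Mathlib's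
convolution group `WithConv (A →ₐ[k] R)`, where `(g h)(a) = ∑ g(a₁) h(a₂)`. -/

/-- For `f : N → G` and `g : K → G` on coordinate rings, the point of `G` over `N × K` given by
`(n, x) ↦ f(n)`. -/
def fstPoint (f : A →ₐ[k] B) (R : Type*) [CommRing R] [Algebra k R] :
    WithConv (A →ₐ[k] B ⊗[k] R) :=
  .toConv (Algebra.TensorProduct.includeLeft.comp f)

/-- The point of `G` over `N × K` given by `(n, x) ↦ g(x)`. -/
def sndPoint (B : Type w) [CommRing B] [Algebra k B] {R : Type*} [CommRing R] [Algebra k R]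
    (g : A →ₐ[k] R) :
    WithConv (A →ₐ[k] B ⊗[k] R) :=
  .toConv (Algebra.TensorProduct.includeRight.comp g)

/-- The comorphism of `N × K → G`, `(n, x) ↦ f(n) g(x)`. -/
noncomputable def mulComorphism {R : Type*} [CommRing R] [Algebra k R] (f : A →ₐ[k] B)
    (g : A →ₐ[k] R) : A →ₐ[k] B ⊗[k] R :=
  (fstPoint f R * sndPoint B g).ofConv

/-- The comorphism of `N × K → G`, `(n, x) ↦ g(x)⁻¹ f(n) g(x)`; inverses of points are given by
composition with the antipode. -/
noncomputable def conjComorphism {R : Type*} [CommRing R] [Algebra k R] (f : A →ₐ[k] B)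
    (g : A →ₐ[k] R) : A →ₐ[k] B ⊗[k] R :=
  (sndPoint B (g.comp (HopfAlgebra.antipodeAlgHom k A)) * fstPoint f R * sndPoint B g).ofConv

/-- The image of an `R`-point under `R → R'`. -/
def pushPoint {R R' : Type*} [CommRing R] [Algebra k R] [CommRing R'] [Algebra k R']
    (q : R →ₐ[k] R') (p : WithConv (A →ₐ[k] R)) : WithConv (A →ₐ[k] R') :=
  .toConv (q.comp p.ofConv)

theorem pushPoint_mul {R R' : Type*} [CommRing R] [Algebra k R] [CommRing R'] [Algebra k R']
    (q : R →ₐ[k] R') (p p' : WithConv (A →ₐ[k] R)) :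
    pushPoint q (p * p') = pushPoint q p * pushPoint q p' :=
  congrArg WithConv.toConv (AlgHom.comp_convMul_distrib q p p')

theorem pushPoint_one {R R' : Type*} [CommRing R] [Algebra k R] [CommRing R'] [Algebra k R']
    (q : R →ₐ[k] R') : pushPoint q (1 : WithConv (A →ₐ[k] R)) = 1 := by
  apply WithConv.ext
  ext a
  exact q.commutes _

theorem antipode_mul_point {R : Type*} [CommRing R] [Algebra k R] (g : A →ₐ[k] R) :
    WithConv.toConv (g.comp (HopfAlgebra.antipodeAlgHom k A)) * WithConv.toConv g = 1 := by
  have h := congrArg (pushPoint g) (AlgHom.antipode_id_cancel (R := k) (A := A))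
  rw [pushPoint_mul, pushPoint_one] at h
  exact h

theorem point_mul_antipode {R : Type*} [CommRing R] [Algebra k R] (g : A →ₐ[k] R) :
    WithConv.toConv g * WithConv.toConv (g.comp (HopfAlgebra.antipodeAlgHom k A)) = 1 := by
  have h := congrArg (pushPoint g)
    (mul_eq_one_comm.mp (AlgHom.antipode_id_cancel (R := k) (A := A)))
  rw [pushPoint_mul, pushPoint_one] at h
  exact h

theorem sndPoint_mul {R : Type*} [CommRing R] [Algebra k R] (g g' : WithConv (A →ₐ[k] R)) :
    sndPoint B (g * g').ofConv = sndPoint B g.ofConv * sndPoint B g'.ofConv :=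
  pushPoint_mul _ g g'

theorem map_comp_conjComorphism {R R' : Type*} [CommRing R] [Algebra k R] [CommRing R']
    [Algebra k R'] (q : R →ₐ[k] R') (f : A →ₐ[k] B) (g : A →ₐ[k] R) :
    (Algebra.TensorProduct.map (AlgHom.id k B) q).comp (conjComorphism f g) =
      conjComorphism f (q.comp g) := by
  have h1 : ∀ g : A →ₐ[k] R, pushPoint (Algebra.TensorProduct.map (AlgHom.id k B) q)
      (sndPoint B g) = sndPoint B (q.comp g) := by
    intro g; apply WithConv.ext; ext; simp [pushPoint, sndPoint]
  have h2 : pushPoint (Algebra.TensorProduct.map (AlgHom.id k B) q)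
      (fstPoint f R) = fstPoint f R' := by
    apply WithConv.ext; ext; simp [pushPoint, fstPoint]
  apply WithConv.toConv_injective
  change pushPoint _ (sndPoint B _ * fstPoint _ R * sndPoint B _) =
    sndPoint B _ * fstPoint _ R' * sndPoint B _
  rw [pushPoint_mul, pushPoint_mul, h1, h1, h2]
  rfl

/-- `G = N ⋉ K`, in terms of the restriction maps `ιN : k[G] → k[N]` and `ιK : k[G] → k[K]`:
`N` and `K` are closed subgroup schemes of `G`, `N` is normal (conjugation `N × G → G`,
`(n, g) ↦ g⁻¹ n g`, factors through `N`), and multiplication `N × K → G` is an isomorphism of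
schemes. -/
structure IsSemidirectProduct (ιN : A →ₐc[k] B) (ιK : A →ₐc[k] C) : Prop where
  surjective_left : Function.Surjective ιN
  surjective_right : Function.Surjective ιK
  normal : ∃ c : B →ₐ[k] B ⊗[k] A,
    c.comp (ιN : A →ₐ[k] B) = conjComorphism (ιN : A →ₐ[k] B) (AlgHom.id k A)
  bijective : Function.Bijective (mulComorphism (ιN : A →ₐ[k] B) (ιK : A →ₐ[k] C))

namespace IsSemidirectProduct

variable {ιN : A →ₐc[k] B} {ιK : A →ₐc[k] C}

theorem exists_conj (h : IsSemidirectProduct ιN ιK) : ∃ c : B →ₐ[k] B ⊗[k] C,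
    c.comp (ιN : A →ₐ[k] B) = conjComorphism (ιN : A →ₐ[k] B) (ιK : A →ₐ[k] C) := by
  obtain ⟨c, hc⟩ := h.normal
  refine ⟨(Algebra.TensorProduct.map (AlgHom.id k B) (ιK : A →ₐ[k] C)).comp c, ?_⟩
  rw [AlgHom.comp_assoc, hc, map_comp_conjComorphism]
  rfl

/-- The comorphism `k[N] → k[N] ⊗ k[K]` of the conjugation `N × K → N`, `(n, x) ↦ x⁻¹ n x`. -/
noncomputable def conj (h : IsSemidirectProduct ιN ιK) : B →ₐ[k] B ⊗[k] C :=
  h.exists_conj.choose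

theorem conj_comp (h : IsSemidirectProduct ιN ιK) : h.conj.comp (ιN : A →ₐ[k] B) =
    conjComorphism (ιN : A →ₐ[k] B) (ιK : A →ₐ[k] C) :=
  h.exists_conj.choose_spec

/-- The right `k[K]`-comodule `k[N]` given by conjugation.  It corresponds to the action
`(x · f)(n) = f(x⁻¹ n x)` of `K` on `k[N]`. -/
noncomputable def conjComodule (h : IsSemidirectProduct ιN ιK) : RightComodule k C B where
  coact := h.conj.toLinearMap
  coassoc := by
    let y : A →ₐ[k] C ⊗[k] C := Algebra.TensorProduct.includeLeft.comp (ιK : A →ₐ[k] C)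
    let z : A →ₐ[k] C ⊗[k] C := Algebra.TensorProduct.includeRight.comp (ιK : A →ₐ[k] C)
    let yz : A →ₐ[k] C ⊗[k] C := (comulAlgHom k C).comp (ιK : A →ₐ[k] C)
    have hyz : WithConv.toConv yz = WithConv.toConv y * WithConv.toConv z := by
      apply WithConv.ext
      ext a
      have h1 := LinearMap.congr_fun ιK.map_comp_comul a
      have h2 : ∀ t : A ⊗[k] A, TensorProduct.map ιK.toLinearMap ιK.toLinearMap t =
          Algebra.TensorProduct.lift y z (fun _ _ => .all ..) t := by
        intro t
        induction t with
        | zero => simp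
        | tmul a b => simp [y, z]; rfl
        | add a b ha hb => simp only [map_add, ha, hb]
      exact h1.symm.trans ((h2 _).trans (AlgHom.convMul_apply (.toConv y) (.toConv z) a).symm)
    have hyz' : WithConv.toConv (yz.comp (HopfAlgebra.antipodeAlgHom k A)) =
        WithConv.toConv (z.comp (HopfAlgebra.antipodeAlgHom k A)) *
        WithConv.toConv (y.comp (HopfAlgebra.antipodeAlgHom k A)) := by
      refine left_inv_eq_right_inv (antipode_mul_point yz) ?_
      rw [hyz, mul_assoc, ← mul_assoc (WithConv.toConv z), point_mul_antipode, one_mul,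
        point_mul_antipode]
    have key : ((Algebra.TensorProduct.assoc k k k B C C).toAlgHom.comp
        ((Algebra.TensorProduct.map h.conj (AlgHom.id k C)).comp h.conj)) =
        (Algebra.TensorProduct.map (AlgHom.id k B) (comulAlgHom k C)).comp h.conj := by
      rw [← AlgHom.cancel_right (f := (ιN : A →ₐ[k] B)) h.surjective_left]
      rw [AlgHom.comp_assoc, AlgHom.comp_assoc, AlgHom.comp_assoc, h.conj_comp,
        map_comp_conjComorphism, ← AlgHom.comp_assoc]
      set Q := (Algebra.TensorProduct.assoc k k k B C C).toAlgHom.comp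
        (Algebra.TensorProduct.map h.conj (AlgHom.id k C)) with hQ
      have h1 : ∀ g : A →ₐ[k] C, pushPoint Q (sndPoint B g) =
          sndPoint B ((Algebra.TensorProduct.includeRight : C →ₐ[k] C ⊗[k] C).comp g) := by
        intro g; apply WithConv.ext; ext; simp [pushPoint, sndPoint, hQ]; rfl
      have h2 : pushPoint Q (fstPoint (ιN : A →ₐ[k] B) C) =
          .toConv (conjComorphism (ιN : A →ₐ[k] B) y) := by
        have h3 := map_comp_conjComorphism
          (Algebra.TensorProduct.includeLeft : C →ₐ[k] C ⊗[k] C)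
          (ιN : A →ₐ[k] B) (ιK : A →ₐ[k] C)
        rw [← h.conj_comp, ← AlgHom.comp_assoc] at h3
        refine Eq.trans ?_ (congrArg WithConv.toConv h3)
        apply WithConv.ext
        ext a
        have h4 : ∀ t : B ⊗[k] C, Algebra.TensorProduct.assoc k k k B C C (t ⊗ₜ 1) =
            Algebra.TensorProduct.map (AlgHom.id k B)
              (Algebra.TensorProduct.includeLeft : C →ₐ[k] C ⊗[k] C) t := by
          intro t
          induction t with
          | zero => simp
          | tmul a b => simp
          | add a b ha hb => simp only [map_add, add_tmul, ha, hb]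
        simpa [pushPoint, fstPoint, hQ] using h4 _
      apply WithConv.toConv_injective
      change pushPoint Q (sndPoint B _ * fstPoint _ C * sndPoint B _) =
        sndPoint B (WithConv.toConv (yz.comp _)).ofConv * fstPoint _ _ *
          sndPoint B (WithConv.toConv yz).ofConv
      rw [pushPoint_mul, pushPoint_mul, h1, h1, h2, hyz, hyz', sndPoint_mul, sndPoint_mul]
      change sndPoint B (z.comp _) * (sndPoint B (y.comp _) * fstPoint _ _ * sndPoint B y) *
        sndPoint B z = _
      simp only [mul_assoc]
    ext b
    exact AlgHom.congr_fun key b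
  counit_coact := by
    have key : (Algebra.TensorProduct.map (AlgHom.id k B) (counitAlgHom k C)).comp h.conj =
        Algebra.TensorProduct.includeLeft := by
      rw [← AlgHom.cancel_right (f := (ιN : A →ₐ[k] B)) h.surjective_left]
      rw [AlgHom.comp_assoc, h.conj_comp, map_comp_conjComorphism]
      have h1 : (counitAlgHom k C).comp (ιK : A →ₐ[k] C) =
          (1 : WithConv (A →ₐ[k] k)).ofConv := by
        ext a; simp
      have h2 : sndPoint B (1 : WithConv (A →ₐ[k] k)).ofConv = 1 := pushPoint_one _
      have h3 : (1 : WithConv (A →ₐ[k] k)).ofConv.comp (HopfAlgebra.antipodeAlgHom k A) =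
          (1 : WithConv (A →ₐ[k] k)).ofConv := by
        ext a; simp
      rw [conjComorphism, h1, h3, h2, one_mul, mul_one]
      rfl
    intro b
    exact AlgHom.congr_fun key b

end IsSemidirectProduct

end SemidirectProduct

/-! Because left translation by `K` is what induction sees, the useful factorisation is `g = x n`
with `x` in `K` and `n` in `N`. It gives an isomorphism `split : k[N] ⊗ k[K] ≃ k[G]` under which the
left `k[K]`-comodule `k[G]` is cofree on `k[N]` (`coact_split_tmul`). Inducing from a cofree
comodule collapses: the coequaliser of `Hom(k[K] ⊗ k[G], M) ⇉ Hom(k[G], M)` is `Hom(k[N], M)`, with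
quotient map `proj` sending `φ` to `b ↦ θ(u ↦ φ(split(b ⊗ u)))`. Restriction of functions to `N`
gives a section `ψ ↦ ψ ∘ ιN` of `proj`; the contraunit law makes it a section, the
contraassociativity law shows that `proj` kills the relations, and an explicit `ω` shows that
nothing else is killed (`ker_proj`).

The contra-action carried over from the induced contramodule is computed by lifting along this
section (`homContramodule_act`). Its restriction to `k[N]` is free because `ιN` respects
comultiplication. Its restriction to `k[K]` is diagonal because `n x = x (x⁻¹ n x)`: rewriting `n x`
in the form `K` times `N` produces the conjugation coaction (`mulComorphism_split_tmul`).

Uniqueness is independent of this: since `k[G] → k[N] ⊗ k[K]` is injective, contraassociativity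
expresses the whole contra-action through the two restrictions (`eq_of_res_eq`). -/

namespace Contramodule

variable {k : Type u} [Field k]
variable {C : Type v} [AddCommGroup C] [Module k C] [Coalgebra k C]
variable {X : Type*} [AddCommGroup X] [Module k X]
variable {Y : Type*} [AddCommGroup Y] [Module k Y]

/-! ### Transport of structure, and determination by two restrictions -/

/-- Transport of a contramodule structure along a linear equivalence. -/
def transport (S : Contramodule k C X) (e : X ≃ₗ[k] Y) : Contramodule k C Y where
  act := e.toLinearMap ∘ₗ S.act ∘ₗ LinearMap.llcomp k C Y X e.symm.toLinearMap
  contraassoc φ := by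
    have h := S.contraassoc (LinearMap.llcomp k C Y X e.symm.toLinearMap ∘ₗ φ)
    refine (congrArg e (Eq.trans ?_ (h.trans ?_)))
    · refine congrArg S.act (LinearMap.ext fun c => ?_)
      exact e.symm_apply_apply _
    · rw [LinearMap.comp_apply, LinearMap.llcomp_apply', ← LinearMap.comp_assoc]
      congr 2; ext; simp
  contraunit y := by
    have h := S.contraunit (e.symm y)
    refine (congrArg e (Eq.trans ?_ h)).trans (e.apply_symm_apply y)
    refine congrArg S.act (LinearMap.ext fun c => ?_)
    simp

theorem isHom_transport (S : Contramodule k C X) (e : X ≃ₗ[k] Y) :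
    S.IsHom (S.transport e) e.toLinearMap := by
  intro φ
  change e _ = e (S.act _)
  congr 2; ext; simp

theorem IsHom.comp {Z : Type*} [AddCommGroup Z] [Module k Z] {S : Contramodule k C X}
    {T : Contramodule k C Y} {U : Contramodule k C Z} {f : X →ₗ[k] Y} {g : Y →ₗ[k] Z}
    (hg : T.IsHom U g) (hf : S.IsHom T f) : S.IsHom U (g ∘ₗ f) := by
  intro φ
  rw [LinearMap.comp_apply, hf, hg, LinearMap.comp_assoc]

/-- If `C → D ⊗ E`, `c ↦ ∑ f c₁ ⊗ g c₂`, is injective, a `C`-contramodule structure is determined by its restrictions along `f` and `g`. -/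
theorem eq_of_res_eq {D : Type*} [AddCommGroup D] [Module k D] [Coalgebra k D]
    {E : Type*} [AddCommGroup E] [Module k E] [Coalgebra k E] (f : C →ₗc[k] D) (g : C →ₗc[k] E)
    (hinj : Function.Injective (TensorProduct.map f.toLinearMap g.toLinearMap ∘ₗ comul))
    {S T : Contramodule k C X} (hf : S.res f = T.res f) (hg : S.res g = T.res g) : S = T := by
  -- Over a field the injection splits, so every `φ` on `C` extends to the map `φ ∘ r` on `D ⊗ E`.
  obtain ⟨r, hr⟩ := LinearMap.exists_leftInverse_of_injective _ (LinearMap.ker_eq_bot.2 hinj)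
  -- Contraassociativity applied to `c ↦ (c' ↦ (φ ∘ r)(f c' ⊗ g c))`; the right side involves `U`
  -- only through its restrictions.
  have key : ∀ (U : Contramodule k C X) (φ : C →ₗ[k] X), U.act φ =
      (U.res g).act ((U.res f).act ∘ₗ (TensorProduct.curry (φ ∘ₗ r)).flip) := by
    intro U φ
    have h := U.contraassoc
      ((LinearMap.lcomp k X f.toLinearMap ∘ₗ (TensorProduct.curry (φ ∘ₗ r)).flip) ∘ₗ g.toLinearMap)
    refine Eq.trans ?_ h.symm
    congr 1
    have e : TensorProduct.lift ((LinearMap.lcomp k X f.toLinearMap ∘ₗ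
        (TensorProduct.curry (φ ∘ₗ r)).flip) ∘ₗ g.toLinearMap).flip =
        (φ ∘ₗ r) ∘ₗ TensorProduct.map f.toLinearMap g.toLinearMap := by
      ext; simp
    rw [e, LinearMap.comp_assoc, LinearMap.comp_assoc, hr, LinearMap.comp_id]
  ext φ
  rw [key S, key T, hf, hg]

end Contramodule

/-! ### Inverses of points and the antipode -/

section Points

open Bialgebra

variable {k : Type u} [Field k]
variable {A : Type v} [CommRing A] [HopfAlgebra k A]
variable {B : Type w} [CommRing B] [HopfAlgebra k B]
variable {C : Type x} [CommRing C] [HopfAlgebra k C]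

/-- The inverse of an `R`-point of an affine group scheme. -/
noncomputable def invPoint {R : Type*} [CommRing R] [Algebra k R] (p : WithConv (A →ₐ[k] R)) :
    WithConv (A →ₐ[k] R) :=
  .toConv (p.ofConv.comp (HopfAlgebra.antipodeAlgHom k A))

theorem invPoint_mul_cancel {R : Type*} [CommRing R] [Algebra k R] (p : WithConv (A →ₐ[k] R)) :
    invPoint p * p = 1 := antipode_mul_point p.ofConv

theorem mul_invPoint_cancel {R : Type*} [CommRing R] [Algebra k R] (p : WithConv (A →ₐ[k] R)) :
    p * invPoint p = 1 := point_mul_antipode p.ofConv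

theorem invPoint_eq_of_mul_eq_one {R : Type*} [CommRing R] [Algebra k R]
    {p q : WithConv (A →ₐ[k] R)} (h : p * q = 1) : invPoint p = q :=
  left_inv_eq_right_inv (invPoint_mul_cancel p) h

theorem invPoint_invPoint {R : Type*} [CommRing R] [Algebra k R] (p : WithConv (A →ₐ[k] R)) :
    invPoint (invPoint p) = p :=
  invPoint_eq_of_mul_eq_one (invPoint_mul_cancel p)

theorem invPoint_mul {R : Type*} [CommRing R] [Algebra k R] (p q : WithConv (A →ₐ[k] R)) :
    invPoint (p * q) = invPoint q * invPoint p := by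
  apply invPoint_eq_of_mul_eq_one
  rw [mul_assoc, ← mul_assoc q, mul_invPoint_cancel, one_mul, mul_invPoint_cancel]

-- The identity of `A` is the generic point of the group scheme, and inverting it twice gives it
-- back.
variable (k A) in
theorem antipodeAlgHom_comp_self : (HopfAlgebra.antipodeAlgHom k A).comp
    (HopfAlgebra.antipodeAlgHom k A) = AlgHom.id k A :=
  congrArg WithConv.ofConv (invPoint_invPoint (WithConv.toConv (AlgHom.id k A)))

/-- Pulling `S * id = 1` on `B` back along `f` makes the left side a left inverse of the point `f`;
it then agrees with the right inverse given by the antipode of `A`. -/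
theorem antipodeAlgHom_comp (f : A →ₐc[k] B) : WithConv.toConv
    ((HopfAlgebra.antipodeAlgHom k B).comp (f : A →ₐ[k] B)) =
      invPoint (.toConv (f : A →ₐ[k] B)) := by
  have h := AlgHom.convMul_comp_bialgHom_distrib
    (.toConv (HopfAlgebra.antipodeAlgHom k B)) (.toConv (AlgHom.id k B)) f
  rw [AlgHom.antipode_id_cancel] at h
  refine left_inv_eq_right_inv (WithConv.ext ?_) (mul_invPoint_cancel _)
  refine h.symm.trans ?_
  ext a
  simp

variable (k A) in
theorem bijective_antipodeAlgHom : Function.Bijective (HopfAlgebra.antipodeAlgHom k A) :=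
  Function.bijective_iff_has_inverse.2 ⟨HopfAlgebra.antipodeAlgHom k A,
    AlgHom.congr_fun (antipodeAlgHom_comp_self k A), AlgHom.congr_fun (antipodeAlgHom_comp_self k A)⟩

/-- Dictionary between Sweedler-style expressions and products of points, used to replace
computations with coproducts by computations in groups. -/
theorem map_comp_comul_eq {R R' : Type*} [CommRing R] [Algebra k R] [CommRing R'] [Algebra k R']
    (f : A →ₐ[k] R) (g : A →ₐ[k] R') :
    WithConv.toConv ((Algebra.TensorProduct.map f g).comp (comulAlgHom k A)) =
      pushPoint (Algebra.TensorProduct.includeLeft : R →ₐ[k] R ⊗[k] R') (.toConv f) *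
      pushPoint Algebra.TensorProduct.includeRight (.toConv g) := by
  rw [AlgHom.convMul_def, ← AlgHom.comp_assoc]
  congr 2
  ext <;> simp [pushPoint]

end Points

/-! ### The factorisation of `G` as `K` times `N` -/

namespace IsSemidirectProduct

open Bialgebra

variable {k : Type u} [Field k]
variable {A : Type v} [CommRing A] [HopfAlgebra k A]
variable {B : Type w} [CommRing B] [HopfAlgebra k B]
variable {C : Type x} [CommRing C] [HopfAlgebra k C]
variable {ιN : A →ₐc[k] B} {ιK : A →ₐc[k] C}

/-- The comorphism of `N × K → G`, `(n, x) ↦ g(x) f(n)`. -/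
noncomputable def _root_.mulComorphismRev (f : A →ₐ[k] B) (g : A →ₐ[k] C) : A →ₐ[k] B ⊗[k] C :=
  (sndPoint B g * fstPoint f C).ofConv

/-- From `x n = (n⁻¹ x⁻¹)⁻¹`: the map is `(n, x) ↦ n x` composed with inversion on `N`, on `K` and
on `G`, all of which are isomorphisms. -/
theorem bijective_mulComorphismRev (h : IsSemidirectProduct ιN ιK) :
    Function.Bijective (mulComorphismRev (ιN : A →ₐ[k] B) (ιK : A →ₐ[k] C)) := by
  let q := Algebra.TensorProduct.map (HopfAlgebra.antipodeAlgHom k B)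
    (HopfAlgebra.antipodeAlgHom k C)
  have hq : Function.Bijective q :=
    (TensorProduct.congr (LinearEquiv.ofBijective (HopfAlgebra.antipodeAlgHom k B).toLinearMap
      (bijective_antipodeAlgHom k B)) (LinearEquiv.ofBijective
      (HopfAlgebra.antipodeAlgHom k C).toLinearMap (bijective_antipodeAlgHom k C))).bijective
  have e : mulComorphismRev (ιN : A →ₐ[k] B) (ιK : A →ₐ[k] C) =
      (q.comp (mulComorphism (ιN : A →ₐ[k] B) (ιK : A →ₐ[k] C))).comp
        (HopfAlgebra.antipodeAlgHom k A) := by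
    have h1 : pushPoint q (fstPoint (ιN : A →ₐ[k] B) C) =
        invPoint (fstPoint (ιN : A →ₐ[k] B) C) := by
      refine Eq.trans ?_ (congrArg
        (pushPoint (Algebra.TensorProduct.includeLeft : B →ₐ[k] B ⊗[k] C)) (antipodeAlgHom_comp ιN))
      apply WithConv.ext
      ext a
      simp [pushPoint, fstPoint, q]
    have h2 : pushPoint q (sndPoint B (ιK : A →ₐ[k] C)) =
        invPoint (sndPoint B (ιK : A →ₐ[k] C)) := by
      refine Eq.trans ?_ (congrArg
        (pushPoint (Algebra.TensorProduct.includeRight : C →ₐ[k] B ⊗[k] C)) (antipodeAlgHom_comp ιK))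
      apply WithConv.ext
      ext a
      simp [pushPoint, sndPoint, q]
    apply WithConv.toConv_injective
    change sndPoint B _ * fstPoint _ C = invPoint (pushPoint q (fstPoint _ C * sndPoint B _))
    rw [pushPoint_mul, h1, h2, invPoint_mul, invPoint_invPoint, invPoint_invPoint]
  rw [e]
  exact (hq.comp h.bijective).comp (bijective_antipodeAlgHom k A)

/-- The comorphism `k[N] ⊗ k[K] ≃ k[G]` of the inverse of `(n, x) ↦ x n`. -/
noncomputable def split (h : IsSemidirectProduct ιN ιK) : B ⊗[k] C ≃ₐ[k] A :=
  (AlgEquiv.ofBijective _ h.bijective_mulComorphismRev).symm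

theorem split_comp (h : IsSemidirectProduct ιN ιK) (a : A) :
    h.split (mulComorphismRev (ιN : A →ₐ[k] B) (ιK : A →ₐ[k] C) a) = a :=
  (AlgEquiv.ofBijective _ h.bijective_mulComorphismRev).symm_apply_apply a

/-- The method for evaluating `split`: once the point `f` is written as a `K`-point times an
`N`-point, with `g` recording the two factors, a function transported by `split` is evaluated on
those factors. -/
theorem algHom_comp_split {R : Type*} [CommRing R] [Algebra k R] (h : IsSemidirectProduct ιN ιK)
    {f : A →ₐ[k] R} {g : B ⊗[k] C →ₐ[k] R}
    (e : WithConv.toConv f = pushPoint g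
      (sndPoint B (ιK : A →ₐ[k] C) * fstPoint (ιN : A →ₐ[k] B) C))
    (t : B ⊗[k] C) : f (h.split t) = g t := by
  have e' : f = g.comp (mulComorphismRev (ιN : A →ₐ[k] B) (ιK : A →ₐ[k] C)) :=
    WithConv.toConv_injective e
  rw [e', AlgHom.comp_apply]
  congr 1
  exact (AlgEquiv.ofBijective _ h.bijective_mulComorphismRev).apply_symm_apply t

/-- The factorisation of `n` in `N` is `1 · n`, so `split (b ⊗ u)` takes the value `b(n) u(1)`
there. -/
theorem left_split_tmul (h : IsSemidirectProduct ιN ιK) (b : B) (u : C) :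
    ιN (h.split (b ⊗ₜ u)) = (counit u : k) • b := by
  have := h.algHom_comp_split (f := (ιN : A →ₐ[k] B)) (g := Algebra.TensorProduct.lift
    (AlgHom.id k B) ((Algebra.ofId k B).comp (counitAlgHom k C)) (fun _ _ => .all ..)) ?_ (b ⊗ₜ u)
  · refine this.trans ?_
    simp [Algebra.ofId_apply, Algebra.smul_def, mul_comm]
  · rw [pushPoint_mul]
    have h1 : pushPoint (Algebra.TensorProduct.lift (AlgHom.id k B)
        ((Algebra.ofId k B).comp (counitAlgHom k C)) (fun _ _ => .all ..))
        (sndPoint B (ιK : A →ₐ[k] C)) = 1 := by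
      apply WithConv.ext; ext a; simp [pushPoint, sndPoint, Algebra.ofId_apply]
    rw [h1, one_mul]
    apply WithConv.ext; ext a; simp [pushPoint, fstPoint]

/-- Cofreeness of `k[G]` over `k[K]`: since `x (y n) = (x y) n`, left translation by `K` changes
only the `K`-factor. -/
theorem coact_split_tmul (h : IsSemidirectProduct ιN ιK) (b : B) (u : C) :
    (LeftComodule.ofCoalgHom ιK.toCoalgHom).coact (h.split (b ⊗ₜ u)) =
      (h.split.toLinearMap ∘ₗ TensorProduct.mk k B C b).lTensor C (comul u) := by
  -- `F` records the factors of `x · g`: with `g = y n`, the `N`-factor is `n` and the `K`-factor is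
  -- `x y`.
  let F : B ⊗[k] C →ₐ[k] C ⊗[k] A := Algebra.TensorProduct.lift
    (Algebra.TensorProduct.includeRight.comp
      (h.split.toAlgHom.comp Algebra.TensorProduct.includeLeft))
    ((Algebra.TensorProduct.map (AlgHom.id k C)
      (h.split.toAlgHom.comp Algebra.TensorProduct.includeRight)).comp (comulAlgHom k C))
    (fun _ _ => .all ..)
  have := h.algHom_comp_split (f := (Algebra.TensorProduct.map (ιK : A →ₐ[k] C)
    (AlgHom.id k A)).comp (comulAlgHom k A)) (g := F) ?_ (b ⊗ₜ u)
  · refine this.trans ?_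
    have h1 : ∀ t : C ⊗[k] C, (1 ⊗ₜ h.split (b ⊗ₜ 1)) * Algebra.TensorProduct.map (AlgHom.id k C)
        (h.split.toAlgHom.comp Algebra.TensorProduct.includeRight) t =
        (h.split.toLinearMap ∘ₗ TensorProduct.mk k B C b).lTensor C t := by
      intro t
      induction t with
      | zero => simp
      | tmul x y => simp [← map_mul]
      | add x y hx hy => simp only [map_add, mul_add, hx, hy]
    simpa [F] using h1 _
  · rw [map_comp_comul_eq, pushPoint_mul]
    -- The generic point of `G`, factored into its `K`- and `N`-parts.
    have h0 : WithConv.toConv (AlgHom.id k A) = pushPoint h.split.toAlgHom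
        (sndPoint B (ιK : A →ₐ[k] C) * fstPoint (ιN : A →ₐ[k] B) C) := by
      apply WithConv.ext; ext a; exact (h.split_comp a).symm
    have h1 : pushPoint F (sndPoint B (ιK : A →ₐ[k] C)) =
        pushPoint Algebra.TensorProduct.includeLeft (.toConv (ιK : A →ₐ[k] C)) *
        pushPoint Algebra.TensorProduct.includeRight
          (pushPoint h.split.toAlgHom (sndPoint B (ιK : A →ₐ[k] C))) := by
      have h2 := map_comp_comul_eq (k := k) (A := C) (AlgHom.id k C)
        (h.split.toAlgHom.comp Algebra.TensorProduct.includeRight)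
      have h3 := AlgHom.convMul_comp_bialgHom_distrib
        (pushPoint (Algebra.TensorProduct.includeLeft : C →ₐ[k] C ⊗[k] A)
          (.toConv (AlgHom.id k C)))
        (pushPoint (Algebra.TensorProduct.includeRight : A →ₐ[k] C ⊗[k] A)
          (.toConv (h.split.toAlgHom.comp Algebra.TensorProduct.includeRight))) ιK
      rw [← h2] at h3
      refine Eq.trans ?_ (congrArg WithConv.toConv h3)
      apply WithConv.ext; ext a
      simp [pushPoint, sndPoint, F, ← Algebra.TensorProduct.one_def]
    have h4 : pushPoint F (fstPoint (ιN : A →ₐ[k] B) C) =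
        pushPoint Algebra.TensorProduct.includeRight
          (pushPoint h.split.toAlgHom (fstPoint (ιN : A →ₐ[k] B) C)) := by
      apply WithConv.ext; ext a; simp [pushPoint, fstPoint, F]
    rw [h0, pushPoint_mul, pushPoint_mul, h1, h4, mul_assoc]

/-- Because `n x = x (x⁻¹ n x)`, the function `split (b ⊗ u)` takes the value `b(x⁻¹ n x) u(x)` at
`n x`. This is where conjugation enters. -/
theorem mulComorphism_split_tmul (h : IsSemidirectProduct ιN ιK) (b : B) (u : C) :
    mulComorphism (ιN : A →ₐ[k] B) (ιK : A →ₐ[k] C) (h.split (b ⊗ₜ u)) =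
      h.conj b * (1 ⊗ₜ u) := by
  have := h.algHom_comp_split (f := mulComorphism (ιN : A →ₐ[k] B) (ιK : A →ₐ[k] C))
    (g := Algebra.TensorProduct.lift h.conj Algebra.TensorProduct.includeRight
      (fun _ _ => .all ..)) ?_ (b ⊗ₜ u)
  · simpa using this
  · have h1 : pushPoint (Algebra.TensorProduct.lift h.conj
        (Algebra.TensorProduct.includeRight : C →ₐ[k] B ⊗[k] C) (fun _ _ => .all ..))
        (sndPoint B (ιK : A →ₐ[k] C)) = sndPoint B (ιK : A →ₐ[k] C) := by
      apply WithConv.ext; ext a; simp [pushPoint, sndPoint]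
    have h2 : pushPoint (Algebra.TensorProduct.lift h.conj
        (Algebra.TensorProduct.includeRight : C →ₐ[k] B ⊗[k] C) (fun _ _ => .all ..))
        (fstPoint (ιN : A →ₐ[k] B) C) = invPoint (sndPoint B (ιK : A →ₐ[k] C)) *
          fstPoint (ιN : A →ₐ[k] B) C * sndPoint B (ιK : A →ₐ[k] C) := by
      refine Eq.trans ?_ (congrArg WithConv.toConv h.conj_comp)
      apply WithConv.ext; ext a
      simp [pushPoint, fstPoint, ← Algebra.TensorProduct.one_def]
    rw [pushPoint_mul, h1, h2]
    change fstPoint _ _ * sndPoint _ _ = _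
    rw [← mul_assoc, ← mul_assoc, mul_invPoint_cancel, one_mul]

theorem mulComorphism_eq (f : A →ₐc[k] B) (g : A →ₐc[k] C) (a : A) :
    mulComorphism (f : A →ₐ[k] B) (g : A →ₐ[k] C) a =
      TensorProduct.map f.toCoalgHom.toLinearMap g.toCoalgHom.toLinearMap (comul a) :=
  (AlgHom.congr_fun (congrArg WithConv.ofConv
    (map_comp_comul_eq (f : A →ₐ[k] B) (g : A →ₐ[k] C))) a).symm

theorem mulComorphismRev_eq (f : A →ₐc[k] B) (g : A →ₐc[k] C) (a : A) :
    mulComorphismRev (f : A →ₐ[k] B) (g : A →ₐ[k] C) a =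
      TensorProduct.comm k C B (TensorProduct.map g.toCoalgHom.toLinearMap
        f.toCoalgHom.toLinearMap (comul a)) := by
  have h1 := congrArg (pushPoint (Algebra.TensorProduct.comm k C B).toAlgHom)
    (map_comp_comul_eq (g : A →ₐ[k] C) (f : A →ₐ[k] B))
  rw [pushPoint_mul] at h1
  refine Eq.trans ?_ (AlgHom.congr_fun (congrArg WithConv.ofConv h1) a).symm
  refine congrArg (fun p : WithConv (A →ₐ[k] B ⊗[k] C) => p.ofConv a)
    (congrArg₂ (· * ·) ?_ ?_) <;>
  · apply WithConv.ext; ext a; simp [pushPoint, fstPoint, sndPoint]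

/-! ### The induced contramodule as a space of maps on `k[N]` -/

variable {M : Type*} [AddCommGroup M] [Module k M]

/-- The map `Hom(k[G], M) → Hom(k[N], M)` that presents `Hom(k[N], M)` as the induced
contramodule. -/
noncomputable def proj (h : IsSemidirectProduct ιN ιK) (θ : Contramodule k C M) :
    (A →ₗ[k] M) →ₗ[k] (B →ₗ[k] M) where
  toFun φ := θ.act ∘ₗ TensorProduct.curry (φ ∘ₗ h.split.toLinearMap)
  map_add' φ φ' := by
    rw [← LinearMap.comp_add]; congr 1
  map_smul' r φ := by
    rw [RingHom.id_apply, ← LinearMap.comp_smul]; congr 1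

theorem proj_apply (h : IsSemidirectProduct ιN ιK) (θ : Contramodule k C M) (φ : A →ₗ[k] M)
    (b : B) : h.proj θ φ b =
      θ.act (φ ∘ₗ h.split.toLinearMap ∘ₗ TensorProduct.mk k B C b) := rfl

/-- By `left_split_tmul` the map fed to `θ` is `u ↦ ε(u) ψ(b)`, so this is the contraunit law. It
supplies a linear section of `proj`. -/
theorem proj_comp_left (h : IsSemidirectProduct ιN ιK) (θ : Contramodule k C M) (ψ : B →ₗ[k] M) :
    h.proj θ (ψ ∘ₗ ιN.toCoalgHom.toLinearMap) = ψ := by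
  ext b
  refine Eq.trans ?_ (θ.contraunit (ψ b))
  rw [proj_apply]
  congr 1
  ext u
  exact (congrArg ψ (h.left_split_tmul b u)).trans (map_smul ψ _ _)

/-- On `split (b ⊗ u)` the coaction is the comultiplication of `u`, so the two terms of the relation
become the two sides of contraassociativity for `θ`. -/
theorem proj_cohomRel (h : IsSemidirectProduct ιN ιK) (θ : Contramodule k C M)
    (ω : C ⊗[k] A →ₗ[k] M) :
    h.proj θ (Contramodule.cohomRel (LeftComodule.ofCoalgHom ιK.toCoalgHom) θ ω) = 0 := by
  ext b
  let s : C →ₗ[k] A := h.split.toLinearMap ∘ₗ TensorProduct.mk k B C b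
  have h1 := θ.contraassoc ((TensorProduct.curry ω).flip ∘ₗ s)
  have h2 : TensorProduct.lift ((TensorProduct.curry ω).flip ∘ₗ s).flip = ω ∘ₗ s.lTensor C := by
    ext; simp
  rw [h2] at h1
  rw [proj_apply]
  change θ.act ((ω ∘ₗ _ - θ.act ∘ₗ (TensorProduct.curry ω).flip) ∘ₗ s) = 0
  rw [LinearMap.sub_comp, map_sub, sub_eq_zero]
  refine Eq.trans ?_ h1.symm
  congr 1
  ext u
  exact congrArg ω (h.coact_split_tmul b u)

theorem sub_proj_mem (h : IsSemidirectProduct ιN ιK) (θ : Contramodule k C M) (φ : A →ₗ[k] M) :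
    φ - h.proj θ φ ∘ₗ ιN.toCoalgHom.toLinearMap ∈
      LinearMap.range (Contramodule.cohomRel (LeftComodule.ofCoalgHom ιK.toCoalgHom) θ) := by
  -- This is `ω(x ⊗ a) = φ(split(ιN a ⊗ x))`. Composed with the coaction it returns `φ`, because
  -- `split` inverts the comorphism of `(n, x) ↦ x n`; contracting `x` by `θ` gives `proj φ` at `ιN
  -- a` by definition.
  let ω : C ⊗[k] A →ₗ[k] M := φ ∘ₗ h.split.toLinearMap ∘ₗ
    (TensorProduct.comm k C B).toLinearMap ∘ₗ ιN.toCoalgHom.toLinearMap.lTensor C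
  refine ⟨ω, ?_⟩
  ext a
  change ω ((LeftComodule.ofCoalgHom ιK.toCoalgHom).coact a) -
    θ.act ((TensorProduct.curry ω).flip a) = φ a - h.proj θ φ _
  congr 1
  · have h1 := h.split_comp a
    rw [mulComorphismRev_eq] at h1
    refine congrArg φ (Eq.trans ?_ h1)
    change h.split (TensorProduct.comm k C B (ιN.toCoalgHom.toLinearMap.lTensor C
      (ιK.toCoalgHom.toLinearMap.rTensor A (comul a)))) = _
    rw [← LinearMap.comp_apply (LinearMap.lTensor C _), LinearMap.lTensor_comp_rTensor]

theorem ker_proj (h : IsSemidirectProduct ιN ιK) (θ : Contramodule k C M) :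
    LinearMap.ker (h.proj θ) =
      LinearMap.range (Contramodule.cohomRel (LeftComodule.ofCoalgHom ιK.toCoalgHom) θ) := by
  apply le_antisymm
  · intro φ hφ
    have h1 := h.sub_proj_mem θ φ
    rwa [LinearMap.mem_ker.1 hφ, LinearMap.zero_comp, sub_zero] at h1
  · rintro _ ⟨ω, rfl⟩
    exact h.proj_cohomRel θ ω

/-- The linear equivalence between the induced contramodule and `Hom(k[N], M)`. -/
noncomputable def cohomEquiv (h : IsSemidirectProduct ιN ιK) (θ : Contramodule k C M) :
    Contramodule.Cohom (LeftComodule.ofCoalgHom ιK.toCoalgHom) θ ≃ₗ[k] (B →ₗ[k] M) :=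
  (Submodule.quotEquivOfEq _ _ (h.ker_proj θ).symm).trans
    ((h.proj θ).quotKerEquivOfSurjective fun ψ => ⟨_, h.proj_comp_left θ ψ⟩)

/-! ### The contra-action of `k[G]` and its two restrictions -/

/-- The `k[G]`-contramodule structure on `Hom(k[N], M)`. -/
noncomputable def homContramodule (h : IsSemidirectProduct ιN ιK) (θ : Contramodule k C M) :
    Contramodule k A (B →ₗ[k] M) :=
  (θ.ind ιK.toCoalgHom).transport (h.cohomEquiv θ)

theorem isHom_proj (h : IsSemidirectProduct ιN ιK) (θ : Contramodule k C M) :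
    (Contramodule.free k A M).IsHom (h.homContramodule θ) (h.proj θ) :=
  (Contramodule.isHom_transport _ (h.cohomEquiv θ)).comp (Contramodule.quotient_act_mkQ _ _ _)

/-- Each `Φ a` lifts along `proj` to `Φ a ∘ ιN`, and `proj` is a homomorphism from the free
contramodule, where the action is explicit. -/
theorem homContramodule_act (h : IsSemidirectProduct ιN ιK) (θ : Contramodule k C M)
    (Φ : A →ₗ[k] B →ₗ[k] M) : (h.homContramodule θ).act Φ = h.proj θ
      (TensorProduct.lift Φ.flip ∘ₗ ιN.toCoalgHom.toLinearMap.rTensor A ∘ₗ comul) := by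
  have h1 := h.isHom_proj θ (LinearMap.lcomp k M ιN.toCoalgHom.toLinearMap ∘ₗ Φ)
  have h2 : h.proj θ ∘ₗ LinearMap.lcomp k M ιN.toCoalgHom.toLinearMap ∘ₗ Φ = Φ := by
    ext1 a; exact h.proj_comp_left θ (Φ a)
  rw [h2] at h1
  refine h1.symm.trans ?_
  rw [Contramodule.free_act_apply, ← LinearMap.comp_assoc]
  congr 2
  ext; simp

/-- For `Φ` pulled back along `ιN`, the argument of `proj` is the free action of `Φ` composed with
`ιN`, as `ιN` preserves comultiplication; `proj` undoes that composition. -/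
theorem homContramodule_res_left (h : IsSemidirectProduct ιN ιK) (θ : Contramodule k C M) :
    (h.homContramodule θ).res ιN.toCoalgHom = Contramodule.free k B M := by
  ext1
  ext1 Φ
  refine (h.homContramodule_act θ (Φ ∘ₗ ιN.toCoalgHom.toLinearMap)).trans ?_
  refine Eq.trans ?_ (h.proj_comp_left θ ((Contramodule.free k B M).act Φ))
  congr 1
  rw [Contramodule.free_act_apply, LinearMap.comp_assoc, ← ιN.toCoalgHom.map_comp_comul,
    ← LinearMap.comp_assoc, ← LinearMap.comp_assoc]
  congr 1
  ext; simp

theorem homContramodule_res_right (h : IsSemidirectProduct ιN ιK) (θ : Contramodule k C M) :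
    (h.homContramodule θ).res ιK.toCoalgHom = Contramodule.diag h.conjComodule θ := by
  ext1
  ext1 Φ
  refine (h.homContramodule_act θ (Φ ∘ₗ ιK.toCoalgHom.toLinearMap)).trans ?_
  ext b
  change _ = θ.act (diagMap Φ (h.conj b))
  rw [proj_apply]
  congr 1
  ext u
  -- Both tensor factors of the coproduct are now restricted, to `N` and to `K`, so only the values
  -- of `a` at products `n x` matter.
  have h1 : ∀ a : A, TensorProduct.lift (Φ ∘ₗ ιK.toCoalgHom.toLinearMap).flip
      (ιN.toCoalgHom.toLinearMap.rTensor A (comul a)) =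
      TensorProduct.lift Φ.flip (mulComorphism (ιN : A →ₐ[k] B) (ιK : A →ₐ[k] C) a) := by
    intro a
    rw [mulComorphism_eq]
    have h3 : TensorProduct.lift (Φ ∘ₗ ιK.toCoalgHom.toLinearMap).flip ∘ₗ
        ιN.toCoalgHom.toLinearMap.rTensor A = TensorProduct.lift Φ.flip ∘ₗ
        TensorProduct.map ιN.toCoalgHom.toLinearMap ιK.toCoalgHom.toLinearMap := by
      ext; simp
    exact LinearMap.congr_fun h3 (comul a)
  -- Multiplying the conjugation coaction of `b` by `1 ⊗ u` gives the element `b₀ ⊗ b₁ u` on which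
  -- the diagonal action evaluates `Φ`.
  have h2 : ∀ t : B ⊗[k] C, TensorProduct.lift Φ.flip (t * (1 ⊗ₜ u)) = diagMap Φ t u := by
    intro t
    induction t with
    | zero => simp
    | tmul x y => simp
    | add x y hx hy => simp only [map_add, add_mul, LinearMap.add_apply, hx, hy]
  rw [← h2, ← h.mulComorphism_split_tmul]
  exact h1 _

end IsSemidirectProduct

theorem mainTheorem9 {k : Type u} [Field k]
    {A : Type v} [CommRing A] [HopfAlgebra k A]
    {B : Type w} [CommRing B] [HopfAlgebra k B]
    {C : Type x} [CommRing C] [HopfAlgebra k C]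
    (ιN : A →ₐc[k] B) (ιK : A →ₐc[k] C) (h : IsSemidirectProduct ιN ιK)
    {M : Type*} [AddCommGroup M] [Module k M] (θ : Contramodule k C M) :
    ∃ T : Contramodule k A (B →ₗ[k] M),
      (T.res ιK.toCoalgHom = Contramodule.diag h.conjComodule θ ∧
        T.res ιN.toCoalgHom = Contramodule.free k B M) ∧
      (∀ T' : Contramodule k A (B →ₗ[k] M),
        T'.res ιK.toCoalgHom = Contramodule.diag h.conjComodule θ →
        T'.res ιN.toCoalgHom = Contramodule.free k B M → T' = T) ∧
      (θ.ind ιK.toCoalgHom).IsIsomorphic T := by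
  refine ⟨h.homContramodule θ, ⟨h.homContramodule_res_right θ, h.homContramodule_res_left θ⟩,
    fun T' hK hN => ?_, h.cohomEquiv θ, Contramodule.isHom_transport _ _⟩
  refine Contramodule.eq_of_res_eq ιN.toCoalgHom ιK.toCoalgHom ?_
    (hN.trans (h.homContramodule_res_left θ).symm) (hK.trans (h.homContramodule_res_right θ).symm)
  -- The map required to be injective is the comorphism of `(n, x) ↦ n x`.
  intro a a' haa
  refine h.bijective.injective ?_
  rw [IsSemidirectProduct.mulComorphism_eq, IsSemidirectProduct.mulComorphism_eq]
  exact haa
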